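/- Call a sequence $E=(e_k)_{k\ge 0}$ of points of the closed unit disk $D=\{z\in\mathbb{C}:|z|\le 1\}$ a Leja sequence if $e_0=1$ and, for every $j\ge 1$, $$\prod_{m=0}^{j-1}|e_j-e_m|=\max_{z\in D}\prod_{m=0}^{j-1}|z-e_m|.$$ A sequence $X=(x_k)_{k\ge 0}$ in $[-1,1]$ is an $\Re$-Leja sequence if there is a Leja sequence $E$ such that $X$ is obtained from the sequence of real parts $(\Re e_k)_{k\ge 0}$ by eliminating repeated values, that is, by keeping, in order, exactly those terms that differ from all the preceding ones. For a finite set $A\subset[-1,1]$, the Lebesgue constant $\Delta(A)$ is the norm of the Lagrange interpolation operator $$f\mapsto \sum_{a\in A} f(a)\prod_{b\in A,\,b\ne a}\frac{\,\cdot\,-b}{a-b}$$ on the space $C([-1,1])$ of continuous real-valued functions on $[-1,1]$ with the sup norm. **Theorem.** For every $\Re$-Leja sequence $X=(x_k)_{k\ge 0}$, the Lebesgue constant of $X_k=\{x_0,\dots,x_{k-1}\}$ satisfies $$\Delta(X_k)=O(k^3\log k)\qquad\text{as } k\to\infty.$$ -/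

import Mathlib

/-- A Leja sequence for the closed unit disk `D = {|z| ≤ 1}` of `ℂ`: a sequence of points of `D`
with `e 0 = 1` such that, for every `j ≥ 1`, the point `e j` maximizes over `D` the product of the
distances to the previous points `e 0, …, e (j - 1)`. -/
def IsLejaSequence (e : ℕ → ℂ) : Prop :=
  e 0 = 1 ∧ (∀ j, e j ∈ Metric.closedBall (0 : ℂ) 1) ∧
    ∀ j, 1 ≤ j →
      IsMaxOn (fun z : ℂ => ∏ m ∈ Finset.range j, ‖z - e m‖) (Metric.closedBall (0 : ℂ) 1) (e j)

/-- `x` is obtained from the sequence `s` by eliminating repeated values: it is the subsequence of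
`s` (given by the strictly increasing map `φ`) that keeps exactly the terms which differ from all
the terms preceding them. -/
def IsRepetitionFreeSubsequence {α : Type*} (s x : ℕ → α) : Prop :=
  ∃ φ : ℕ → ℕ, StrictMono φ ∧ Set.range φ = {n | ∀ m < n, s m ≠ s n} ∧ ∀ k, x k = s (φ k)

/-- A sequence `X` in `[-1, 1]` is a `ℜ`-Leja sequence if it is obtained by eliminating repeated
values in the sequence of real parts of a Leja sequence. -/
def IsReLejaSequence (X : ℕ → Set.Icc (-1 : ℝ) 1) : Prop :=
  ∃ e : ℕ → ℂ, IsLejaSequence e ∧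
    IsRepetitionFreeSubsequence (fun n => (e n).re) (fun k => (X k : ℝ))

/-- The Lagrange interpolation operator `f ↦ ∑ a ∈ A, f a • ℓ(A, a; ·)` on `C(K)`, for a finite
set `A` of points of a compact set `K` of real numbers, where `ℓ(A, a; ·)` is the fundamental
Lagrange interpolation polynomial `∏ b ∈ A, b ≠ a, (· - b) / (a - b)`. -/
noncomputable def lagrangeOperator {K : Set ℝ} [CompactSpace K] (A : Finset K) :
    C(K, ℝ) →L[ℝ] C(K, ℝ) :=
  ∑ a ∈ A, (ContinuousMap.evalCLM ℝ a).smulRight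
    ((Lagrange.basis A (fun b : K => (b : ℝ)) a).toContinuousMapOn K)

/-- The Lebesgue constant `Δ(A) = Δ(A, K)`: the norm of the Lagrange interpolation operator at the
points of `A` as an operator on `C(K)` with the sup norm. -/
noncomputable def lebesgueConstant {K : Set ℝ} [CompactSpace K] (A : Finset K) : ℝ :=
  ‖lagrangeOperator A‖

/-! Leja points have a dyadic structure: the first `2 ^ n` are the `2 ^ n`-th roots of unity
(`prod_sub`), and the following ones, divided by `e (2 ^ n)`, again form a Leja section (`tail`).
Induction on `n` over this splitting bounds nodal polynomials below off the roots of unity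
(`prod_norm_mul_le`) and fundamental polynomials on the disk by `2 ^ n` (`prod_erase_le`).

For unit `z`, `w`, `2 |Re z - Re w| = |z - w| |conj z - w|`, so products over real nodes become
pairs of products over Leja points, at `z` and `conj z`. The nodes are the real parts of the `2 ^ (n
+ 1)`-th roots of unity together with `m ≤ 2 ^ n` points of the next block; the second half of that
block only repeats real parts by conjugation. Every fundamental polynomial is then at most `4 * 4 ^
n ≤ 4 * k ^ 2` on `[-1, 1]`, and summing `k` of them gives `4 * k ^ 3`, without a logarithm. -/

/-! ### Finite Leja sections and their extension -/

/-- The first `M` terms of `e` satisfy the conditions defining a Leja sequence of the unit disk. -/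
def IsLejaSection (M : ℕ) (e : ℕ → ℂ) : Prop :=
  e 0 = 1 ∧ (∀ j < M, ‖e j‖ ≤ 1) ∧
    ∀ j, 1 ≤ j → j < M → ∀ z : ℂ, ‖z‖ ≤ 1 →
      ∏ i ∈ Finset.range j, ‖z - e i‖ ≤ ∏ i ∈ Finset.range j, ‖e j - e i‖

theorem IsLejaSequence.isLejaSection {e : ℕ → ℂ} (he : IsLejaSequence e) (M : ℕ) :
    IsLejaSection M e := by
  refine ⟨he.1, fun j _ => by simpa using he.2.1 j, fun j hj _ z hz => ?_⟩
  exact he.2.2 j hj (by simpa using hz)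

namespace IsLejaSection

theorem mono {M M' : ℕ} {e : ℕ → ℂ} (he : IsLejaSection M e) (h : M' ≤ M) :
    IsLejaSection M' e :=
  ⟨he.1, fun j hj => he.2.1 j (hj.trans_le h), fun j hj hj' => he.2.2 j hj (hj'.trans_le h)⟩

theorem exists_succ {M : ℕ} {e : ℕ → ℂ} (hM : 1 ≤ M) (he : IsLejaSection M e) :
    ∃ e' : ℕ → ℂ, (∀ j < M, e' j = e j) ∧ IsLejaSection (M + 1) e' := by
  obtain ⟨u, hu, hmax⟩ := (isCompact_closedBall (0 : ℂ) 1).exists_isMaxOn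
    (f := fun z : ℂ => ∏ i ∈ Finset.range M, ‖z - e i‖) ⟨0, by simp⟩ (by fun_prop)
  have hlt : ∀ j < M, Function.update e M u j = e j := fun j hj =>
    Function.update_of_ne hj.ne _ _
  have hprod : ∀ j ≤ M, ∀ z : ℂ, ∏ i ∈ Finset.range j, ‖z - Function.update e M u i‖ =
      ∏ i ∈ Finset.range j, ‖z - e i‖ := fun j hj z =>
    Finset.prod_congr rfl fun i hi => by rw [hlt i ((Finset.mem_range.1 hi).trans_le hj)]
  refine ⟨Function.update e M u, hlt, ?_, fun j hj => ?_, fun j hj hj' z hz => ?_⟩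
  · rw [hlt 0 hM, he.1]
  · rcases Nat.lt_succ_iff_lt_or_eq.1 hj with h | rfl
    · rw [hlt j h]; exact he.2.1 j h
    · simpa using hu
  · rw [hprod j (Nat.lt_succ_iff.1 hj'), hprod j (Nat.lt_succ_iff.1 hj')]
    rcases Nat.lt_succ_iff_lt_or_eq.1 hj' with h | rfl
    · rw [hlt j h]; exact he.2.2 j hj h z hz
    · simpa using hmax (by simpa using hz : z ∈ Metric.closedBall (0 : ℂ) 1)

theorem exists_extension {M M' : ℕ} {e : ℕ → ℂ} (hM : 1 ≤ M) (h : M ≤ M')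
    (he : IsLejaSection M e) :
    ∃ e' : ℕ → ℂ, (∀ j < M, e' j = e j) ∧ IsLejaSection M' e' := by
  induction M', h using Nat.le_induction with
  | base => exact ⟨e, fun _ _ => rfl, he⟩
  | succ K hK ih =>
    obtain ⟨e₁, h₁, h₁'⟩ := ih
    obtain ⟨e₂, h₂, h₂'⟩ := h₁'.exists_succ (hM.trans hK)
    exact ⟨e₂, fun j hj => (h₂ j (hj.trans_le hK)).trans (h₁ j hj), h₂'⟩

end IsLejaSection

theorem norm_pow_sub_one_le_two {z : ℂ} (hz : ‖z‖ ≤ 1) (k : ℕ) : ‖z ^ k - 1‖ ≤ 2 := by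
  calc ‖z ^ k - 1‖ ≤ ‖z ^ k‖ + ‖(1 : ℂ)‖ := norm_sub_le _ _
    _ ≤ 1 + 1 := by
      rw [norm_pow, norm_one]; gcongr; exact pow_le_one₀ (norm_nonneg _) hz
    _ = 2 := by norm_num

theorem eq_neg_one_of_two_le_norm_sub_one {w : ℂ} (hw : ‖w‖ ≤ 1) (h : 2 ≤ ‖w - 1‖) : w = -1 := by
  have h1 : ‖w‖ ^ 2 ≤ 1 := pow_le_one₀ (norm_nonneg _) hw
  have h2 : (2 : ℝ) ^ 2 ≤ ‖w - 1‖ ^ 2 := by gcongr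
  rw [← Complex.normSq_eq_norm_sq, Complex.normSq_apply] at h1 h2
  simp only [Complex.sub_re, Complex.sub_im, Complex.one_re, Complex.one_im] at h2
  have hre : w.re = -1 := by nlinarith [sq_nonneg w.im, sq_nonneg (w.re + 1)]
  have him : w.im = 0 := by
    rw [hre] at h1
    have : w.im * w.im ≤ 0 := by linarith
    nlinarith [mul_self_nonneg w.im]
  exact Complex.ext (by simp [hre]) (by simp [him])

theorem norm_eq_one_of_pow_eq_neg_one {z : ℂ} {k : ℕ} (hk : k ≠ 0) (h : z ^ k = -1) :
    ‖z‖ = 1 := by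
  have : ‖z‖ ^ k = 1 := by rw [← norm_pow, h]; simp
  exact (pow_eq_one_iff_of_nonneg (norm_nonneg _) hk).1 this

theorem norm_div_sub_div {ρ : ℂ} (hρ : ‖ρ‖ = 1) (y w : ℂ) : ‖y / ρ - w / ρ‖ = ‖y - w‖ := by
  rw [← sub_div, norm_div, hρ, div_one]

theorem prod_erase_eq_prod_ite (s : Finset ℕ) (k : ℕ) (f : ℕ → ℝ) :
    ∏ i ∈ s.erase k, f i = ∏ i ∈ s, if i = k then 1 else f i := by
  rw [← Finset.filter_ne', Finset.prod_filter]
  exact Finset.prod_congr rfl fun i _ => by by_cases h : i = k <;> simp [h]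

/-! ### Dyadic structure of Leja sections -/

namespace IsLejaSection

/-- The product over a longer section is `‖z ^ 2 ^ n - 1‖` times a tail product. The first factor is
at most 2, with equality at every root of unity times `e (2 ^ n)`; the tail product has a maximizer
of this form, so both factors peak together. `hroots` is a hypothesis because `prod_sub` obtains it
by an induction that uses this lemma. -/
theorem pow_eq_neg_one_and_tail {n m : ℕ} {e : ℕ → ℂ}
    (hroots : ∀ e' : ℕ → ℂ, IsLejaSection (2 ^ n) e' →
      ∀ z, ∏ i ∈ Finset.range (2 ^ n), (z - e' i) = z ^ 2 ^ n - 1)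
    (hm : 1 ≤ m) (hmn : m ≤ 2 ^ n) (he : IsLejaSection (2 ^ n + m) e) :
    e (2 ^ n) ^ 2 ^ n = -1 ∧ IsLejaSection m (fun j => e (2 ^ n + j) / e (2 ^ n)) := by
  have hprod : ∀ z, ∏ i ∈ Finset.range (2 ^ n), ‖z - e i‖ = ‖z ^ 2 ^ n - 1‖ := fun z => by
    rw [← hroots e (he.mono (Nat.le_add_right _ _)), norm_prod]
  have hN : 2 ^ n ≠ 0 := by positivity
  have hρ : e (2 ^ n) ^ 2 ^ n = -1 := by
    obtain ⟨z₀, hz₀⟩ := IsAlgClosed.exists_pow_nat_eq (-1 : ℂ) (Nat.pos_of_ne_zero hN)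
    have h := he.2.2 (2 ^ n) (Nat.one_le_two_pow) (by omega) z₀
      (norm_eq_one_of_pow_eq_neg_one hN hz₀).le
    rw [hprod, hprod, hz₀] at h
    refine eq_neg_one_of_two_le_norm_sub_one ?_ (le_trans (by norm_num) h)
    rw [norm_pow]
    exact pow_le_one₀ (norm_nonneg _) (he.2.1 _ (by omega))
  refine ⟨hρ, ?_⟩
  have hρ1 : ‖e (2 ^ n)‖ = 1 := norm_eq_one_of_pow_eq_neg_one hN hρ
  have hρ0 : e (2 ^ n) ≠ 0 := norm_ne_zero_iff.1 (by rw [hρ1]; exact one_ne_zero)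
  induction m, hm using Nat.le_induction with
  | base =>
    refine ⟨by simp [hρ0], fun j hj => ?_, fun j hj hj' => by omega⟩
    rw [norm_div, hρ1, div_one]
    exact he.2.1 _ (by omega)
  | succ m hm ih =>
    have ih' := ih (by omega) (he.mono (by omega))
    refine ⟨ih'.1, fun j hj => ?_, fun j hj hj' z hz => ?_⟩
    · rw [norm_div, hρ1, div_one]
      exact he.2.1 _ (by omega)
    · rcases Nat.lt_succ_iff_lt_or_eq.1 hj' with h | rfl
      · exact ih'.2.2 j hj h z hz
      -- Any next Leja point `u` of the rotated tail is a `2 ^ n`-th root of unity, since the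
      -- section extends to length `2 ^ n`. Testing the maximality of `e (2 ^ n + j)` against `u * e
      -- (2 ^ n)` then suffices.
      · obtain ⟨e₁, h₁, h₁'⟩ := ih'.exists_succ hm
        obtain ⟨e₂, h₂, h₂'⟩ := h₁'.exists_extension (by omega) hmn
        set u := e₂ j with hu
        have hun : u ^ 2 ^ n = 1 := by
          have := hroots e₂ h₂' u
          rw [Finset.prod_eq_zero (Finset.mem_range.2 (show j < 2 ^ n by omega))
            (sub_self _)] at this
          exact (sub_eq_zero.1 this.symm)
        have hu1 : ‖u‖ = 1 := by
          have : ‖u‖ ^ 2 ^ n = 1 := by rw [← norm_pow, hun, norm_one]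
          exact (pow_eq_one_iff_of_nonneg (norm_nonneg _) hN).1 this
        have hzu : ∏ i ∈ Finset.range j, ‖z - e (2 ^ n + i) / e (2 ^ n)‖ ≤
            ∏ i ∈ Finset.range j, ‖u - e (2 ^ n + i) / e (2 ^ n)‖ := by
          have h3 := h₂'.2.2 j hj (by omega) z hz
          have h4 : ∀ y : ℂ, ∏ i ∈ Finset.range j, ‖y - e₂ i‖ =
              ∏ i ∈ Finset.range j, ‖y - e (2 ^ n + i) / e (2 ^ n)‖ := fun y =>
            Finset.prod_congr rfl fun i hi => by
              have hi := Finset.mem_range.1 hi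
              rw [h₂ i (by omega), h₁ i hi]
          rwa [h4, h4] at h3
        refine hzu.trans ?_
        have key := he.2.2 (2 ^ n + j) (by omega) (by omega) (u * e (2 ^ n))
          (by rw [norm_mul, hu1, hρ1, one_mul])
        have hsplit : ∀ y : ℂ, ∏ i ∈ Finset.range (2 ^ n + j), ‖y - e i‖ =
            ‖y ^ 2 ^ n - 1‖ *
              ∏ i ∈ Finset.range j, ‖y / e (2 ^ n) - e (2 ^ n + i) / e (2 ^ n)‖ := fun y => by
          rw [Finset.prod_range_add, hprod]
          simp only [norm_div_sub_div hρ1]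
        rw [hsplit, hsplit, mul_pow, hun, hρ, mul_div_cancel_right₀ _ hρ0] at key
        have h2 : ‖(1 : ℂ) * -1 - 1‖ = 2 := by norm_num
        rw [h2] at key
        have h5 := mul_le_mul_of_nonneg_right
          (norm_pow_sub_one_le_two (he.2.1 (2 ^ n + j) (by omega)) (2 ^ n))
          (Finset.prod_nonneg fun i (_ : i ∈ Finset.range j) =>
            norm_nonneg (e (2 ^ n + j) / e (2 ^ n) - e (2 ^ n + i) / e (2 ^ n)))
        exact le_of_mul_le_mul_left (key.trans h5) two_pos

theorem prod_sub {n : ℕ} {e : ℕ → ℂ} (he : IsLejaSection (2 ^ n) e) (z : ℂ) :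
    ∏ i ∈ Finset.range (2 ^ n), (z - e i) = z ^ 2 ^ n - 1 := by
  induction n generalizing e z with
  | zero => simp [he.1]
  | succ n ih =>
    have h2 : 2 ^ (n + 1) = 2 ^ n + 2 ^ n := by ring
    rw [h2] at he
    obtain ⟨hρ, ht⟩ := pow_eq_neg_one_and_tail (fun e' h' z => ih h' z) Nat.one_le_two_pow
      le_rfl he
    have hρ0 : e (2 ^ n) ≠ 0 := by
      intro h0
      rw [h0, zero_pow (by positivity)] at hρ
      norm_num at hρ
    rw [h2, Finset.prod_range_add, ih (he.mono (Nat.le_add_right _ _))]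
    have h3 : ∏ i ∈ Finset.range (2 ^ n), (z - e (2 ^ n + i)) = z ^ 2 ^ n + 1 := by
      have h4 := ih ht (z / e (2 ^ n))
      simp only [← sub_div] at h4
      rw [Finset.prod_div_distrib, Finset.prod_const, Finset.card_range, hρ, div_pow, hρ] at h4
      linear_combination (-1) * h4
    rw [h3]
    ring

theorem pow_eq_neg_one {n m : ℕ} {e : ℕ → ℂ} (hm : 1 ≤ m) (he : IsLejaSection (2 ^ n + m) e) :
    e (2 ^ n) ^ 2 ^ n = -1 :=
  (pow_eq_neg_one_and_tail (fun _ h z => h.prod_sub z) le_rfl Nat.one_le_two_pow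
    (he.mono (by omega))).1

theorem tail {n m : ℕ} {e : ℕ → ℂ} (hm : 1 ≤ m) (hmn : m ≤ 2 ^ n)
    (he : IsLejaSection (2 ^ n + m) e) :
    IsLejaSection m (fun j => e (2 ^ n + j) / e (2 ^ n)) :=
  (pow_eq_neg_one_and_tail (fun _ h z => h.prod_sub z) hm hmn he).2

theorem pow_eq_one {n m j : ℕ} {e : ℕ → ℂ} (he : IsLejaSection m e) (hj : j < m)
    (hmn : m ≤ 2 ^ n) : e j ^ 2 ^ n = 1 := by
  obtain ⟨e₁, h₁, h₁'⟩ := he.exists_extension (by omega) hmn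
  have := h₁'.prod_sub (e j)
  rw [Finset.prod_eq_zero (Finset.mem_range.2 (hj.trans_le hmn))
    (by rw [h₁ j hj, sub_self])] at this
  exact sub_eq_zero.1 this.symm

theorem norm_eq_one {m j : ℕ} {e : ℕ → ℂ} (he : IsLejaSection m e) (hj : j < m) :
    ‖e j‖ = 1 := by
  have h := he.pow_eq_one hj Nat.lt_two_pow_self.le
  have : ‖e j‖ ^ 2 ^ m = 1 := by rw [← norm_pow, h, norm_one]
  exact (pow_eq_one_iff_of_nonneg (norm_nonneg _) (by positivity)).1 this

/-- A repeated point would make the maximal product zero, whereas it equals 1 at the origin. -/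
theorem ne_of_lt {m i j : ℕ} {e : ℕ → ℂ} (he : IsLejaSection m e) (hij : i < j) (hj : j < m) :
    e j ≠ e i := by
  intro h
  have h1 := he.2.2 j (by omega) hj 0 (by simp)
  rw [Finset.prod_eq_zero (f := fun k => ‖e j - e k‖) (Finset.mem_range.2 hij)
      (by rw [h, sub_self, norm_zero]),
    Finset.prod_eq_one fun k hk => by
      rw [zero_sub, norm_neg]
      exact he.norm_eq_one ((Finset.mem_range.1 hk).trans hj)] at h1
  exact absurd h1 (by norm_num)

theorem injOn {m : ℕ} {e : ℕ → ℂ} (he : IsLejaSection m e) :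
    Set.InjOn e (Finset.range m) := by
  intro i hi j hj h
  simp only [Finset.coe_range, Set.mem_Iio] at hi hj
  rcases lt_trichotomy i j with hij | hij | hij
  · exact absurd h.symm (he.ne_of_lt hij hj)
  · exact hij
  · exact absurd h (he.ne_of_lt hij hi)

theorem norm_prod_tail {n m : ℕ} {e : ℕ → ℂ} (hm : 1 ≤ m) (he : IsLejaSection (2 ^ n + m) e)
    (y : ℂ) : ∏ i ∈ Finset.range (2 ^ n + m), ‖y - e i‖ = ‖y ^ 2 ^ n - 1‖ *
      ∏ i ∈ Finset.range m, ‖y / e (2 ^ n) - e (2 ^ n + i) / e (2 ^ n)‖ := by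
  rw [Finset.prod_range_add, ← (he.mono (Nat.le_add_right _ _)).prod_sub, norm_prod]
  simp only [norm_div_sub_div (he.norm_eq_one (Nat.lt_add_of_pos_right hm))]

/-! ### Nodal and fundamental polynomials on the disk -/

/-- The nodal polynomial of a Leja section of length at most `2 ^ n` cannot be much smaller than its
maximum away from the `2 ^ n`-th roots of unity. -/
theorem prod_norm_mul_le {n m : ℕ} {e : ℕ → ℂ} (he : IsLejaSection m e) (hmn : m ≤ 2 ^ n)
    {y u : ℂ} (hy : ‖y‖ ≤ 1) (hu : ‖u‖ ≤ 1) :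
    (∏ i ∈ Finset.range m, ‖y - e i‖) * ‖u ^ 2 ^ n - 1‖ ≤
      2 ^ (n + 1) * ∏ i ∈ Finset.range m, ‖u - e i‖ := by
  induction n generalizing m e y u with
  | zero =>
    rcases Nat.le_one_iff_eq_zero_or_eq_one.1 (by simpa using hmn) with rfl | rfl
    · simpa using norm_pow_sub_one_le_two hu 1
    · have := norm_pow_sub_one_le_two hy 1
      rw [pow_one] at this
      simp only [Finset.prod_range_one, he.1, pow_zero, pow_one, zero_add]
      gcongr
  | succ n ih =>
    have hfac : ‖u ^ 2 ^ (n + 1) - 1‖ = ‖u ^ 2 ^ n - 1‖ * ‖u ^ 2 ^ n + 1‖ := by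
      rw [← norm_mul]
      congr 1
      ring
    rcases le_or_gt m (2 ^ n) with h | h
    · have h1 : ‖u ^ 2 ^ n + 1‖ ≤ 2 := by
        refine (norm_add_le _ _).trans ?_
        rw [norm_pow, norm_one]
        linarith [pow_le_one₀ (n := 2 ^ n) (norm_nonneg u) hu]
      have h2 := ih he h hy hu
      have h3 := Finset.prod_nonneg fun i (_ : i ∈ Finset.range m) => norm_nonneg (y - e i)
      calc _ = (∏ i ∈ Finset.range m, ‖y - e i‖) * ‖u ^ 2 ^ n - 1‖ * ‖u ^ 2 ^ n + 1‖ := by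
            rw [hfac, mul_assoc]
        _ ≤ (2 ^ (n + 1) * ∏ i ∈ Finset.range m, ‖u - e i‖) * 2 := by gcongr
        _ = _ := by ring
    · obtain ⟨m', rfl⟩ := Nat.exists_eq_add_of_le h.le
      have hm' : 1 ≤ m' := by omega
      have hm2 : m' ≤ 2 ^ n := by rw [pow_succ] at hmn; omega
      have hρ := he.pow_eq_neg_one hm'
      have hρ1 : ‖e (2 ^ n)‖ = 1 := he.norm_eq_one (by omega)
      have h2 := ih (he.tail hm' hm2) hm2 (y := y / e (2 ^ n)) (u := u / e (2 ^ n))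
        (by rwa [norm_div, hρ1, div_one]) (by rwa [norm_div, hρ1, div_one])
      -- Of the two factors of `u ^ 2 ^ (n + 1) - 1`, this one feeds the induction on the tail; the
      -- other already occurs in the nodal product at `u`.
      have h3 : ‖(u / e (2 ^ n)) ^ 2 ^ n - 1‖ = ‖u ^ 2 ^ n + 1‖ := by
        rw [div_pow, hρ, ← norm_neg]
        congr 1
        ring
      rw [h3] at h2
      rw [he.norm_prod_tail hm', he.norm_prod_tail hm', hfac]
      have h4 := norm_pow_sub_one_le_two hy (2 ^ n)
      set P := ∏ i ∈ Finset.range m', ‖y / e (2 ^ n) - e (2 ^ n + i) / e (2 ^ n)‖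
      set Q := ∏ i ∈ Finset.range m', ‖u / e (2 ^ n) - e (2 ^ n + i) / e (2 ^ n)‖
      calc ‖y ^ 2 ^ n - 1‖ * P * (‖u ^ 2 ^ n - 1‖ * ‖u ^ 2 ^ n + 1‖)
          = ‖y ^ 2 ^ n - 1‖ * ‖u ^ 2 ^ n - 1‖ * (P * ‖u ^ 2 ^ n + 1‖) := by ring
        _ ≤ 2 * ‖u ^ 2 ^ n - 1‖ * (2 ^ (n + 1) * Q) := by gcongr
        _ = _ := by ring

open Polynomial in
-- This is the geometric sum for `(y ^ N - e j ^ N) / (y - e j)`. Cancelling between polynomials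
-- makes it valid at `y = e j` too.
theorem prod_erase_sub {n j : ℕ} {e : ℕ → ℂ} (he : IsLejaSection (2 ^ n) e) (hj : j < 2 ^ n)
    (y : ℂ) : ∏ i ∈ (Finset.range (2 ^ n)).erase j, (y - e i) =
      ∑ i ∈ Finset.range (2 ^ n), y ^ i * e j ^ (2 ^ n - 1 - i) := by
  have h1 : ∏ i ∈ Finset.range (2 ^ n), (X - C (e i)) = X ^ 2 ^ n - 1 := by
    refine Polynomial.funext fun z => ?_
    simpa [eval_prod] using he.prod_sub z
  have h2 : (∑ i ∈ Finset.range (2 ^ n), X ^ i * C (e j) ^ (2 ^ n - 1 - i)) * (X - C (e j)) =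
      X ^ 2 ^ n - 1 := by
    rw [(Commute.all _ _).geom_sum₂_mul, ← C_pow, he.pow_eq_one hj le_rfl, C_1]
  rw [← Finset.prod_erase_mul _ _ (Finset.mem_range.2 hj), ← h2] at h1
  have h3 := congrArg (eval y) (mul_right_cancel₀ (X_sub_C_ne_zero _) h1)
  simpa [eval_prod, eval_finsetSum] using h3

theorem prod_erase_norm_le {n j : ℕ} {e : ℕ → ℂ} (he : IsLejaSection (2 ^ n) e) (hj : j < 2 ^ n)
    {y : ℂ} (hy : ‖y‖ ≤ 1) : ∏ i ∈ (Finset.range (2 ^ n)).erase j, ‖y - e i‖ ≤ 2 ^ n := by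
  rw [← norm_prod, he.prod_erase_sub hj]
  refine (norm_sum_le _ _).trans ?_
  calc _ ≤ ∑ i ∈ Finset.range (2 ^ n), (1 : ℝ) := Finset.sum_le_sum fun i _ => by
        rw [norm_mul, norm_pow, norm_pow, he.norm_eq_one hj, one_pow, mul_one]
        exact pow_le_one₀ (norm_nonneg _) hy
    _ = _ := by simp

theorem prod_erase_norm_self {n j : ℕ} {e : ℕ → ℂ} (he : IsLejaSection (2 ^ n) e)
    (hj : j < 2 ^ n) : ∏ i ∈ (Finset.range (2 ^ n)).erase j, ‖e j - e i‖ = 2 ^ n := by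
  rw [← norm_prod, he.prod_erase_sub hj, Finset.sum_congr rfl fun i hi => by
    rw [← pow_add, Nat.add_sub_cancel' (by have := Finset.mem_range.1 hi; omega)]]
  simp [he.norm_eq_one hj]

/-- The fundamental Lagrange polynomials of a Leja section of length at most `2 ^ n` are bounded by
`2 ^ n` on the unit disk. -/
theorem prod_erase_le {n m j : ℕ} {e : ℕ → ℂ} (he : IsLejaSection m e) (hmn : m ≤ 2 ^ n)
    (hj : j < m) {y : ℂ} (hy : ‖y‖ ≤ 1) :
    ∏ i ∈ (Finset.range m).erase j, ‖y - e i‖ ≤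
      2 ^ n * ∏ i ∈ (Finset.range m).erase j, ‖e j - e i‖ := by
  induction n generalizing m e y j with
  | zero =>
    obtain rfl : m = 1 := by simp at hmn; omega
    obtain rfl : j = 0 := by omega
    simp
  | succ n ih =>
    rcases le_or_gt m (2 ^ n) with h | h
    · refine (ih he h hj hy).trans ?_
      have := Finset.prod_nonneg fun i (_ : i ∈ (Finset.range m).erase j) =>
        norm_nonneg (e j - e i)
      gcongr
      · exact one_le_two
      · exact n.le_succ
    · obtain ⟨m', rfl⟩ := Nat.exists_eq_add_of_le h.le
      have hm' : 1 ≤ m' := by omega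
      have hm2 : m' ≤ 2 ^ n := by rw [pow_succ] at hmn; omega
      have hρ := he.pow_eq_neg_one hm'
      have hρ1 : ‖e (2 ^ n)‖ = 1 := he.norm_eq_one (by omega)
      have ht := he.tail hm' hm2
      have h0 := he.mono (Nat.le_add_right _ _)
      rcases lt_or_ge j (2 ^ n) with hjn | hjn
      · have hs : ∀ z : ℂ, ∏ i ∈ (Finset.range (2 ^ n + m')).erase j, ‖z - e i‖ =
            (∏ i ∈ (Finset.range (2 ^ n)).erase j, ‖z - e i‖) *
              ∏ i ∈ Finset.range m', ‖z / e (2 ^ n) - e (2 ^ n + i) / e (2 ^ n)‖ := fun z => by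
          have h1 := Finset.prod_range_add
            (fun i => if i = j then 1 else ‖z - e i‖) (2 ^ n) m'
          simp only [norm_div_sub_div hρ1]
          rw [prod_erase_eq_prod_ite, prod_erase_eq_prod_ite, h1]
          congr 1
          exact Finset.prod_congr rfl fun i _ => by rw [if_neg (by omega)]
        -- For a node among the roots of unity, the first factor is largest at the node itself, and
        -- only the tail factor costs a power of 2.
        rw [hs, hs, h0.prod_erase_norm_self hjn]
        have h4 := ht.prod_norm_mul_le hm2 (y := y / e (2 ^ n)) (u := e j / e (2 ^ n))
          (by rwa [norm_div, hρ1, div_one])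
          (by rw [norm_div, hρ1, div_one, he.norm_eq_one hj])
        have h5 : ‖(e j / e (2 ^ n)) ^ 2 ^ n - 1‖ = 2 := by
          rw [div_pow, hρ, h0.pow_eq_one hjn le_rfl]
          norm_num
        rw [h5] at h4
        have h6 := h0.prod_erase_norm_le hjn hy
        set P := ∏ i ∈ Finset.range m', ‖y / e (2 ^ n) - e (2 ^ n + i) / e (2 ^ n)‖ with hP
        set Q := ∏ i ∈ Finset.range m', ‖e j / e (2 ^ n) - e (2 ^ n + i) / e (2 ^ n)‖ with hQ
        have hP0 : 0 ≤ P := Finset.prod_nonneg fun i _ => norm_nonneg _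
        have hQ0 : 0 ≤ Q := Finset.prod_nonneg fun i _ => norm_nonneg _
        have h7 : P ≤ 2 ^ (n + 1) * Q := by linarith
        calc _ ≤ 2 ^ n * P := by gcongr
          _ ≤ 2 ^ n * (2 ^ (n + 1) * Q) := by gcongr
          _ = _ := by ring
      · obtain ⟨j', rfl⟩ := Nat.exists_eq_add_of_le hjn
        have hj' : j' < m' := by omega
        have hs : ∀ z : ℂ, ∏ i ∈ (Finset.range (2 ^ n + m')).erase (2 ^ n + j'), ‖z - e i‖ =
            ‖z ^ 2 ^ n - 1‖ * ∏ i ∈ (Finset.range m').erase j',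
              ‖z / e (2 ^ n) - e (2 ^ n + i) / e (2 ^ n)‖ := fun z => by
          have h1 := Finset.prod_range_add
            (fun i => if i = 2 ^ n + j' then 1 else ‖z - e i‖) (2 ^ n) m'
          simp only [norm_div_sub_div hρ1]
          rw [prod_erase_eq_prod_ite, prod_erase_eq_prod_ite, h1, ← h0.prod_sub, norm_prod]
          congr 1
          · exact Finset.prod_congr rfl fun i hi => by
              rw [if_neg (by have := Finset.mem_range.1 hi; omega)]
          · simp only [Nat.add_left_cancel_iff]
        rw [hs, hs]
        have h4 := ih ht hm2 hj' (y := y / e (2 ^ n)) (by rwa [norm_div, hρ1, div_one])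
        have h5 : ‖e (2 ^ n + j') ^ 2 ^ n - 1‖ = 2 := by
          have := ht.pow_eq_one hj' hm2
          rw [div_pow, hρ, div_eq_iff (by norm_num)] at this
          rw [this]
          norm_num
        rw [h5]
        set P := ∏ i ∈ (Finset.range m').erase j', ‖y / e (2 ^ n) - e (2 ^ n + i) / e (2 ^ n)‖
          with hP
        have hP0 : 0 ≤ P := Finset.prod_nonneg fun i _ => norm_nonneg _
        have hQ0 : 0 ≤ ∏ i ∈ (Finset.range m').erase j',
          ‖e (2 ^ n + j') / e (2 ^ n) - e (2 ^ n + i) / e (2 ^ n)‖ :=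
          Finset.prod_nonneg fun i _ => norm_nonneg _
        calc _ ≤ 2 * (2 ^ n * _) := mul_le_mul (norm_pow_sub_one_le_two hy _) h4 hP0 two_pos.le
          _ = 2 ^ (n + 1) * (1 * ∏ i ∈ (Finset.range m').erase j',
            ‖e (2 ^ n + j') / e (2 ^ n) - e (2 ^ n + i) / e (2 ^ n)‖) := by ring
          _ ≤ _ := by gcongr; norm_num

end IsLejaSection

/-! ### Projection of the circle to the real axis -/

open ComplexConjugate

/-- Expanding with `z * conj z = w * conj w = 1` gives `(z - w) * (conj z - w) = -2 * w * (Re z - Re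
w)`. -/
theorem Complex.abs_re_sub_re {z w : ℂ} (hz : ‖z‖ = 1) (hw : ‖w‖ = 1) :
    2 * |z.re - w.re| = ‖z - w‖ * ‖conj z - w‖ := by
  have hz' : z * conj z = 1 := by rw [Complex.mul_conj, Complex.normSq_eq_norm_sq, hz]; simp
  have hw' : w * conj w = 1 := by rw [Complex.mul_conj, Complex.normSq_eq_norm_sq, hw]; simp
  have h1 : (z - w) * (conj z - w) = -(w * ((2 * (z.re - w.re) : ℝ) : ℂ)) := by
    have h2 := Complex.add_conj z
    have h3 := Complex.add_conj w
    push_cast at h2 h3 ⊢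
    linear_combination hz' - hw' - w * h2 + w * h3
  rw [← norm_mul, h1, norm_neg, norm_mul, hw, one_mul, Complex.norm_real, Real.norm_eq_abs,
    abs_mul, abs_two]

theorem Complex.eq_or_eq_conj_of_re_eq {z w : ℂ} (hz : ‖z‖ = 1) (hw : ‖w‖ = 1)
    (h : z.re = w.re) : z = w ∨ conj z = w := by
  have := Complex.abs_re_sub_re hz hw
  rw [h, sub_self, abs_zero, mul_zero, zero_eq_mul, norm_eq_zero, norm_eq_zero] at this
  exact this.imp sub_eq_zero.1 sub_eq_zero.1

theorem Complex.exists_norm_eq_one_re_eq {x : ℝ} (hx : x ∈ Set.Icc (-1 : ℝ) 1) :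
    ∃ z : ℂ, ‖z‖ = 1 ∧ z.re = x := by
  refine ⟨⟨x, √(1 - x ^ 2)⟩, ?_, rfl⟩
  have h : 0 ≤ 1 - x ^ 2 := by nlinarith [hx.1, hx.2]
  refine (pow_eq_one_iff_of_nonneg (norm_nonneg _) two_ne_zero).1 ?_
  rw [← Complex.normSq_eq_norm_sq, Complex.normSq_apply]
  simp only
  rw [Real.mul_self_sqrt h]
  ring

theorem Complex.prod_abs_re_sub_re {z : ℂ} (hz : ‖z‖ = 1) (s : Finset ℕ) {f : ℕ → ℂ}
    (hf : ∀ i ∈ s, ‖f i‖ = 1) :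
    2 ^ s.card * ∏ i ∈ s, |z.re - (f i).re| =
      (∏ i ∈ s, ‖z - f i‖) * ∏ i ∈ s, ‖conj z - f i‖ := by
  rw [← Finset.prod_const, ← Finset.prod_mul_distrib, ← Finset.prod_mul_distrib]
  exact Finset.prod_congr rfl fun i hi => Complex.abs_re_sub_re hz (hf i hi)

theorem Complex.norm_sq_sub_one {z : ℂ} (hz : ‖z‖ = 1) : ‖z ^ 2 - 1‖ = ‖z - conj z‖ := by
  have hz' : z * conj z = 1 := by rw [Complex.mul_conj, Complex.normSq_eq_norm_sq, hz]; simp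
  rw [← hz', sq, ← mul_sub, norm_mul, hz, one_mul]

/-- The product of the distances to the other nodes, on `[-1, 1]`, is at most `C` times its value at
the node `a`: the fundamental Lagrange polynomial at `a` is bounded by `C`. -/
def NodeBound (S : Finset ℝ) (a C : ℝ) : Prop :=
  ∀ x ∈ Set.Icc (-1 : ℝ) 1, ∏ b ∈ S.erase a, |x - b| ≤ C * ∏ b ∈ S.erase a, |a - b|

/-- The real parts of the first `J` terms of `e`. -/
noncomputable def reNodes (e : ℕ → ℂ) (J : ℕ) : Finset ℝ :=
  (Finset.range J).image fun i => (e i).re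

/-- The real parts of the `m` terms of `e` that follow the first `2 ^ (n + 1)` ones. -/
noncomputable def blockNodes (e : ℕ → ℂ) (n m : ℕ) : Finset ℝ :=
  (Finset.range m).image fun i => (e (2 ^ (n + 1) + i)).re

theorem reNodes_add (e : ℕ → ℂ) (n m : ℕ) :
    reNodes e (2 ^ (n + 1) + m) = reNodes e (2 ^ (n + 1)) ∪ blockNodes e n m := by
  ext x
  simp only [reNodes, blockNodes, Finset.mem_union, Finset.mem_image, Finset.mem_range]
  constructor
  · rintro ⟨i, hi, rfl⟩
    rcases lt_or_ge i (2 ^ (n + 1)) with h | h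
    · exact Or.inl ⟨i, h, rfl⟩
    · exact Or.inr ⟨i - 2 ^ (n + 1), by omega, by rw [Nat.add_sub_cancel' h]⟩
  · rintro (⟨i, hi, rfl⟩ | ⟨i, hi, rfl⟩)
    · exact ⟨i, by omega, rfl⟩
    · exact ⟨_, by omega, rfl⟩

theorem blockNodes_mono (e : ℕ → ℂ) (n : ℕ) {m m' : ℕ} (h : m ≤ m') :
    blockNodes e n m ⊆ blockNodes e n m' :=
  Finset.image_subset_image (Finset.range_mono h)

/-! ### The block after the first `2 ^ (n + 1)` points, and conjugation -/

namespace IsLejaSequence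

variable {e : ℕ → ℂ}

theorem norm_eq_one (he : IsLejaSequence e) (i : ℕ) : ‖e i‖ = 1 :=
  (he.isLejaSection (i + 1)).norm_eq_one i.lt_succ_self

theorem injective (he : IsLejaSequence e) : Function.Injective e := fun i j h =>
  (he.isLejaSection (max i j + 1)).injOn (by simp) (by simp) h

theorem norm_pow_eq_one (he : IsLejaSequence e) (i k : ℕ) : ‖e i ^ k‖ = 1 := by
  rw [norm_pow, he.norm_eq_one, one_pow]

theorem pow_eq_one (he : IsLejaSequence e) {n i : ℕ} (hi : i < 2 ^ n) : e i ^ 2 ^ n = 1 :=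
  (he.isLejaSection (2 ^ n)).pow_eq_one hi le_rfl

theorem pow_mul_pow (he : IsLejaSequence e) (n : ℕ) :
    e (2 ^ (n + 1)) ^ 2 ^ n * e (2 ^ (n + 1)) ^ 2 ^ n = -1 := by
  rw [← pow_add, ← two_mul, ← pow_succ']
  exact (he.isLejaSection _).pow_eq_neg_one le_rfl

/-- The power is a square root of `-1`. Hence conjugation exchanges the two halves of the block, on
which the `2 ^ n`-th power takes opposite values. -/
theorem conj_pow (he : IsLejaSequence e) (n : ℕ) :
    conj (e (2 ^ (n + 1)) ^ 2 ^ n) = -e (2 ^ (n + 1)) ^ 2 ^ n := by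
  have h1 := he.pow_mul_pow n
  have h2 : e (2 ^ (n + 1)) ^ 2 ^ n * conj (e (2 ^ (n + 1)) ^ 2 ^ n) = 1 := by
    rw [Complex.mul_conj, Complex.normSq_eq_norm_sq, he.norm_pow_eq_one]; simp
  have h3 : e (2 ^ (n + 1)) ^ 2 ^ n ≠ 0 := fun h => by rw [h] at h1; norm_num at h1
  refine mul_left_cancel₀ h3 ?_
  rw [h2]
  linear_combination h1

theorem ne_zero (he : IsLejaSequence e) (i : ℕ) : e i ≠ 0 :=
  norm_ne_zero_iff.1 (by rw [he.norm_eq_one]; exact one_ne_zero)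

theorem block_tail (he : IsLejaSequence e) {n m : ℕ} (hm : 1 ≤ m) (hmn : m ≤ 2 ^ (n + 1)) :
    IsLejaSection m (fun j => e (2 ^ (n + 1) + j) / e (2 ^ (n + 1))) :=
  (he.isLejaSection _).tail hm hmn

theorem block_pow (he : IsLejaSequence e) {n i : ℕ} (hi : i < 2 ^ n) :
    e (2 ^ (n + 1) + i) ^ 2 ^ n = e (2 ^ (n + 1)) ^ 2 ^ n := by
  have := (he.block_tail Nat.one_le_two_pow
    (Nat.pow_le_pow_right two_pos n.le_succ)).pow_eq_one hi le_rfl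
  rwa [div_pow, div_eq_one_iff_eq (pow_ne_zero _ (he.ne_zero _))] at this

theorem block_pow_succ (he : IsLejaSequence e) {n i : ℕ} (hi : i < 2 ^ n) :
    e (2 ^ (n + 1) + i) ^ 2 ^ (n + 1) = -1 := by
  rw [← he.pow_mul_pow n, ← he.block_pow hi]
  ring

theorem block_pow_neg (he : IsLejaSequence e) {n i : ℕ} (hi : i < 2 ^ n) :
    e (2 ^ (n + 1) + (2 ^ n + i)) ^ 2 ^ n = -e (2 ^ (n + 1)) ^ 2 ^ n := by
  have h1 := he.block_tail (n := n) (m := 2 ^ n + 2 ^ n) (by have := Nat.two_pow_pos n; omega)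
    (by rw [pow_succ]; omega)
  have h2 := h1.pow_eq_neg_one Nat.one_le_two_pow
  have h3 := (h1.tail Nat.one_le_two_pow le_rfl).pow_eq_one hi le_rfl
  have h4 := he.ne_zero (2 ^ (n + 1))
  rw [div_pow, h2, div_pow, div_eq_iff (by norm_num), one_mul,
    div_eq_iff (pow_ne_zero _ h4)] at h3
  rw [h3]
  ring

theorem block_prod_mul_le (he : IsLejaSequence e) {n m : ℕ} (hmn : m ≤ 2 ^ n) {y u : ℂ}
    (hy : ‖y‖ ≤ 1) (hu : ‖u‖ ≤ 1) :
    (∏ i ∈ Finset.range m, ‖y - e (2 ^ (n + 1) + i)‖) * ‖u ^ 2 ^ n - e (2 ^ (n + 1)) ^ 2 ^ n‖ ≤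
      2 ^ (n + 1) * ∏ i ∈ Finset.range m, ‖u - e (2 ^ (n + 1) + i)‖ := by
  have hρ1 := he.norm_eq_one (2 ^ (n + 1))
  have h := (((he.block_tail Nat.one_le_two_pow
    (Nat.pow_le_pow_right two_pos n.le_succ)).mono hmn).prod_norm_mul_le hmn
    (y := y / e (2 ^ (n + 1))) (u := u / e (2 ^ (n + 1)))
    (by rwa [norm_div, hρ1, div_one]) (by rwa [norm_div, hρ1, div_one]))
  simp only [norm_div_sub_div hρ1] at h
  rwa [div_pow, ← div_self (pow_ne_zero (2 ^ n) (he.ne_zero (2 ^ (n + 1)))),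
    norm_div_sub_div (he.norm_pow_eq_one _ _)] at h

theorem block_prod_erase_le (he : IsLejaSequence e) {n m j : ℕ} (hmn : m ≤ 2 ^ n) (hj : j < m)
    {y : ℂ} (hy : ‖y‖ ≤ 1) :
    ∏ i ∈ (Finset.range m).erase j, ‖y - e (2 ^ (n + 1) + i)‖ ≤
      2 ^ n * ∏ i ∈ (Finset.range m).erase j,
        ‖e (2 ^ (n + 1) + j) - e (2 ^ (n + 1) + i)‖ := by
  have hρ1 := he.norm_eq_one (2 ^ (n + 1))
  have h := (((he.block_tail Nat.one_le_two_pow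
    (Nat.pow_le_pow_right two_pos n.le_succ)).mono hmn).prod_erase_le hmn hj
    (y := y / e (2 ^ (n + 1))) (by rwa [norm_div, hρ1, div_one]))
  simpa only [norm_div_sub_div hρ1] using h

theorem block_prod (he : IsLejaSequence e) (n : ℕ) (y : ℂ) :
    ∏ i ∈ Finset.range (2 ^ n), ‖y - e (2 ^ (n + 1) + i)‖ =
      ‖y ^ 2 ^ n - e (2 ^ (n + 1)) ^ 2 ^ n‖ := by
  have hρ1 := he.norm_eq_one (2 ^ (n + 1))
  have h := congrArg norm ((he.block_tail Nat.one_le_two_pow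
    (Nat.pow_le_pow_right two_pos n.le_succ)).prod_sub (y / e (2 ^ (n + 1))))
  rw [norm_prod] at h
  simp only [norm_div_sub_div hρ1] at h
  rwa [div_pow, ← div_self (pow_ne_zero (2 ^ n) (he.ne_zero (2 ^ (n + 1)))),
    norm_div_sub_div (he.norm_pow_eq_one _ _)] at h

theorem full_block_prod_erase_le (he : IsLejaSequence e) {n j : ℕ} (hj : j < 2 ^ n)
    {y : ℂ} (hy : ‖y‖ ≤ 1) :
    ∏ i ∈ (Finset.range (2 ^ n)).erase j, ‖y - e (2 ^ (n + 1) + i)‖ ≤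
      ∏ i ∈ (Finset.range (2 ^ n)).erase j,
        ‖e (2 ^ (n + 1) + j) - e (2 ^ (n + 1) + i)‖ := by
  have hρ1 := he.norm_eq_one (2 ^ (n + 1))
  have ht := he.block_tail (n := n) Nat.one_le_two_pow
    (Nat.pow_le_pow_right two_pos n.le_succ)
  have h := ht.prod_erase_norm_le hj
    (y := y / e (2 ^ (n + 1))) (by rwa [norm_div, hρ1, div_one])
  rw [← ht.prod_erase_norm_self hj] at h
  simpa only [norm_div_sub_div hρ1] using h

theorem norm_pow_sub_mul (he : IsLejaSequence e) (n : ℕ) (z : ℂ) :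
    ‖z ^ 2 ^ n - e (2 ^ (n + 1)) ^ 2 ^ n‖ * ‖conj z ^ 2 ^ n - e (2 ^ (n + 1)) ^ 2 ^ n‖ =
      ‖z ^ 2 ^ (n + 1) + 1‖ := by
  rw [← Complex.norm_conj (conj z ^ 2 ^ n - _), map_sub, he.conj_pow, map_pow, Complex.conj_conj,
    ← norm_mul]
  congr 1
  linear_combination (-1) * he.pow_mul_pow n

/-! ### Coincidences among real parts, and real nodal products -/

/-- Equal real parts at distinct points force conjugate points, but conjugation changes the sign of
the `2 ^ n`-th power, which is constant on this half-block. -/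
theorem block_re_injOn (he : IsLejaSequence e) (n : ℕ) :
    Set.InjOn (fun i => (e (2 ^ (n + 1) + i)).re) (Finset.range (2 ^ n)) := by
  intro i hi j hj h
  simp only [Finset.coe_range, Set.mem_Iio] at hi hj
  rcases Complex.eq_or_eq_conj_of_re_eq (he.norm_eq_one _) (he.norm_eq_one _) h with h | h
  · have := he.injective h
    omega
  · exfalso
    have h1 := congrArg (· ^ 2 ^ n) h
    simp only [← map_pow] at h1
    rw [he.block_pow hi, he.block_pow hj, he.conj_pow] at h1
    have h2 : e (2 ^ (n + 1)) ^ 2 ^ n = 0 := by linear_combination (-1 / 2) * h1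
    exact pow_ne_zero _ (he.ne_zero _) h2

theorem disjoint_blockNodes (he : IsLejaSequence e) {n m : ℕ} (hm : m ≤ 2 ^ n) :
    Disjoint (reNodes e (2 ^ (n + 1))) (blockNodes e n m) := by
  rw [Finset.disjoint_left]
  simp only [reNodes, blockNodes, Finset.mem_image, Finset.mem_range]
  rintro x ⟨i, hi, rfl⟩ ⟨j, hj, h⟩
  have hj' := he.block_pow_succ (hj.trans_le hm)
  have hi' := he.pow_eq_one hi
  rcases Complex.eq_or_eq_conj_of_re_eq (he.norm_eq_one _) (he.norm_eq_one _) h with h | h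
  · rw [h, hi'] at hj'
    norm_num at hj'
  · rw [← h, ← map_pow, hj'] at hi'
    norm_num at hi'

theorem reNodes_three_mul (he : IsLejaSequence e) {n m : ℕ} (hm : 2 ^ n ≤ m)
    (hm' : m ≤ 2 ^ (n + 1)) :
    reNodes e (2 ^ (n + 1) + m) = reNodes e (2 ^ (n + 1) + 2 ^ n) := by
  rw [reNodes_add, reNodes_add]
  congr 1
  refine Finset.Subset.antisymm ?_ (blockNodes_mono e n hm)
  intro x
  simp only [blockNodes, Finset.mem_image, Finset.mem_range]
  rintro ⟨j, hj, rfl⟩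
  rcases lt_or_ge j (2 ^ n) with h | h
  · exact ⟨j, h, rfl⟩
  · obtain ⟨i, rfl⟩ := Nat.exists_eq_add_of_le h
    have h1 := he.block_pow_neg (n := n) (i := i) (by rw [pow_succ] at hm'; omega)
    -- The nodal product of the first half-block vanishes at the conjugate of a second-half point,
    -- so that conjugate is in the first half.
    have h2 := he.block_prod n (conj (e (2 ^ (n + 1) + (2 ^ n + i))))
    rw [← map_pow, h1, map_neg, he.conj_pow, neg_neg, sub_self, norm_zero,
      Finset.prod_eq_zero_iff] at h2
    obtain ⟨k, hk, hk'⟩ := h2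
    refine ⟨k, Finset.mem_range.1 hk, ?_⟩
    rw [← sub_eq_zero.1 (norm_eq_zero.1 hk'), Complex.conj_re]

theorem reNodes_succ (he : IsLejaSequence e) (n : ℕ) :
    reNodes e (2 ^ (n + 2)) = reNodes e (2 ^ (n + 1)) ∪ blockNodes e n (2 ^ n) := by
  rw [← reNodes_add, ← he.reNodes_three_mul (m := 2 ^ (n + 1))
    (Nat.pow_le_pow_right two_pos n.le_succ) le_rfl]
  congr 1
  ring

theorem reNodes_two (he : IsLejaSequence e) : reNodes e (2 ^ (0 + 1)) = {1, -1} := by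
  have h1 := (he.isLejaSection (2 ^ 0 + 1)).pow_eq_neg_one le_rfl
  simp only [pow_zero, pow_one] at h1
  ext x
  simp [reNodes, Finset.range_add_one, h1, he.1, or_comm]

theorem card_reNodes (he : IsLejaSequence e) (n : ℕ) :
    (reNodes e (2 ^ (n + 1))).card = 2 ^ n + 1 := by
  induction n with
  | zero =>
    rw [he.reNodes_two, Finset.card_pair (by norm_num)]
    rfl
  | succ n ih =>
    rw [he.reNodes_succ, Finset.card_union_of_disjoint (he.disjoint_blockNodes le_rfl), ih,
      blockNodes, Finset.card_image_of_injOn (he.block_re_injOn n), Finset.card_range]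
    ring

theorem prod_blockNodes (he : IsLejaSequence e) {n m : ℕ} (hm : m ≤ 2 ^ n) {z : ℂ}
    (hz : ‖z‖ = 1) : 2 ^ m * ∏ b ∈ blockNodes e n m, |z.re - b| =
      (∏ i ∈ Finset.range m, ‖z - e (2 ^ (n + 1) + i)‖) *
        ∏ i ∈ Finset.range m, ‖conj z - e (2 ^ (n + 1) + i)‖ := by
  rw [blockNodes, Finset.prod_image ((he.block_re_injOn n).mono (by simpa using hm)),
    ← Complex.prod_abs_re_sub_re hz _ fun i _ => he.norm_eq_one _, Finset.card_range]

theorem prod_full_blockNodes (he : IsLejaSequence e) (n : ℕ) {z : ℂ} (hz : ‖z‖ = 1) :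
    2 ^ 2 ^ n * ∏ b ∈ blockNodes e n (2 ^ n), |z.re - b| = ‖z ^ 2 ^ (n + 1) + 1‖ := by
  rw [he.prod_blockNodes le_rfl hz, he.block_prod, he.block_prod, he.norm_pow_sub_mul]

/-- The extra factor `z ^ 2 - 1` arises because `1` and `-1` are their own conjugates and so are
counted twice. -/
theorem prod_reNodes (he : IsLejaSequence e) (n : ℕ) {z : ℂ} (hz : ‖z‖ = 1) :
    2 ^ (2 ^ n + 1) * ∏ a ∈ reNodes e (2 ^ (n + 1)), |z.re - a| =
      ‖z ^ 2 - 1‖ * ‖z ^ 2 ^ (n + 1) - 1‖ := by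
  induction n with
  | zero =>
    rw [he.reNodes_two, Finset.prod_pair (by norm_num)]
    have h1 := Complex.abs_re_sub_re hz (w := 1) (by simp)
    have h2 := Complex.abs_re_sub_re hz (w := -1) (by simp)
    have h3 : ∀ w : ℂ, ‖conj z - conj w‖ = ‖z - w‖ := fun w => by
      rw [← map_sub, Complex.norm_conj]
    have h4 := h3 1
    have h5 := h3 (-1)
    simp only [map_neg, map_one] at h4 h5
    rw [h4] at h1
    rw [h5] at h2
    simp only [Complex.neg_re, Complex.one_re] at h1 h2
    have h6 : ‖z ^ 2 - 1‖ = ‖z - 1‖ * ‖z - -1‖ := by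
      rw [← norm_mul]
      congr 1
      ring
    have h7 : (2 : ℕ) ^ (0 + 1) = 2 := rfl
    have h8 : (2 : ℕ) ^ 0 + 1 = 2 := rfl
    rw [h7, h8, h6]
    linear_combination 2 * |z.re - -1| * h1 + ‖z - 1‖ * ‖z - 1‖ * h2
  | succ n ih =>
    rw [he.reNodes_succ, Finset.prod_union (he.disjoint_blockNodes le_rfl)]
    have h1 := he.prod_full_blockNodes n hz
    have h2 : ‖z ^ 2 ^ (n + 2) - 1‖ = ‖z ^ 2 ^ (n + 1) - 1‖ * ‖z ^ 2 ^ (n + 1) + 1‖ := by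
      rw [← norm_mul]
      congr 1
      ring
    rw [h2, ← h1, ← mul_assoc, ← mul_assoc, ← ih, pow_succ 2 n]
    ring

/-! ### Bounds for the real fundamental polynomials -/

/-- With `w` the node's Leja point, `h₁` handles the product without `w` at one of `z`, `conj z`,
and `h₂` the full product at the other, compared with `conj w`. The missing factor `‖z - w‖` or
`‖conj z - w‖` comes from the endpoint factor `‖z - conj z‖`, by the triangle inequality; its two
terms give the 2. -/
theorem nodeBound_block (he : IsLejaSequence e) {n m j : ℕ} (hm : m ≤ 2 ^ n) (hj : j < m)
    {K₁ K₂ : ℝ} (hK₂ : 0 ≤ K₂)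
    (h₁ : ∀ y : ℂ, ‖y‖ ≤ 1 → ∏ i ∈ (Finset.range m).erase j, ‖y - e (2 ^ (n + 1) + i)‖ ≤
      K₁ * ∏ i ∈ (Finset.range m).erase j, ‖e (2 ^ (n + 1) + j) - e (2 ^ (n + 1) + i)‖)
    (h₂ : ∀ y : ℂ, ‖y‖ ≤ 1 → ∏ i ∈ Finset.range m, ‖y - e (2 ^ (n + 1) + i)‖ ≤
      K₂ * ∏ i ∈ Finset.range m, ‖conj (e (2 ^ (n + 1) + j)) - e (2 ^ (n + 1) + i)‖) :
    NodeBound (reNodes e (2 ^ (n + 1)) ∪ blockNodes e n m) (e (2 ^ (n + 1) + j)).re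
      (2 * K₁ * K₂) := by
  intro x hx
  obtain ⟨z, hz, rfl⟩ := Complex.exists_norm_eq_one_re_eq hx
  set T := (Finset.range m).erase j with hT
  set w := e (2 ^ (n + 1) + j) with hw
  have hinj := (he.block_re_injOn n).mono (Finset.coe_subset.2 (Finset.range_mono hm))
  have hd := he.disjoint_blockNodes hm
  have hmem : w.re ∈ blockNodes e n m :=
    Finset.mem_image.2 ⟨j, Finset.mem_range.2 hj, rfl⟩
  have hnot : w.re ∉ reNodes e (2 ^ (n + 1)) := fun h => Finset.disjoint_left.1 hd h hmem
  have herase : (blockNodes e n m).erase w.re = T.image fun i => (e (2 ^ (n + 1) + i)).re := by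
    ext y
    simp only [hT, hw, blockNodes, Finset.mem_erase, Finset.mem_image]
    constructor
    · rintro ⟨hy, i, hi, rfl⟩
      exact ⟨i, ⟨fun h => hy (by rw [h]), hi⟩, rfl⟩
    · rintro ⟨i, ⟨hij, hi⟩, rfl⟩
      exact ⟨fun h => hij (hinj hi (Finset.mem_range.2 hj) h), i, hi, rfl⟩
  have hprod : ∀ y : ℝ, ∏ b ∈ (reNodes e (2 ^ (n + 1)) ∪ blockNodes e n m).erase w.re, |y - b| =
      (∏ a ∈ reNodes e (2 ^ (n + 1)), |y - a|) * ∏ i ∈ T, |y - (e (2 ^ (n + 1) + i)).re| := by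
    intro y
    rw [Finset.erase_union_distrib, Finset.erase_eq_of_notMem hnot,
      Finset.prod_union (hd.mono_right (Finset.erase_subset _ _)), herase,
      Finset.prod_image (hinj.mono (Finset.coe_subset.2 (Finset.erase_subset _ _)))]
  have hw1 : ‖w‖ = 1 := he.norm_eq_one _
  have hcw1 : ‖conj w‖ = 1 := by rw [Complex.norm_conj, hw1]
  have hcz : ‖conj z‖ = 1 := by rw [Complex.norm_conj, hz]
  have hfull : ∀ y : ℂ, ∏ i ∈ Finset.range m, ‖y - e (2 ^ (n + 1) + i)‖ =
      ‖y - w‖ * ∏ i ∈ T, ‖y - e (2 ^ (n + 1) + i)‖ := fun y =>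
    (Finset.mul_prod_erase _ _ (Finset.mem_range.2 hj)).symm
  have hscaled : ∀ y : ℂ, ‖y‖ = 1 → 2 ^ (2 ^ n + 1) * 2 ^ T.card *
      ∏ b ∈ (reNodes e (2 ^ (n + 1)) ∪ blockNodes e n m).erase w.re, |y.re - b| =
      ‖y - conj y‖ * ‖y ^ 2 ^ (n + 1) - 1‖ * ((∏ i ∈ T, ‖y - e (2 ^ (n + 1) + i)‖) *
        ∏ i ∈ T, ‖conj y - e (2 ^ (n + 1) + i)‖) := by
    intro y hy
    rw [hprod, ← Complex.norm_sq_sub_one hy, ← he.prod_reNodes n hy,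
      ← Complex.prod_abs_re_sub_re hy T fun i _ => he.norm_eq_one _]
    ring
  have hw2 : ‖w ^ 2 ^ (n + 1) - 1‖ = 2 := by
    rw [he.block_pow_succ (hj.trans_le hm)]
    norm_num
  have hpos : (0 : ℝ) < 2 ^ (2 ^ n + 1) * 2 ^ T.card := by positivity
  refine le_of_mul_le_mul_left ?_ hpos
  rw [hscaled z hz, mul_left_comm _ (2 * K₁ * K₂), hscaled w hw1, hw2]
  have a1 := h₁ z hz.le
  have a2 := h₁ (conj z) hcz.le
  have b1 := h₂ z hz.le
  have b2 := h₂ (conj z) hcz.le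
  rw [hfull, hfull (conj w)] at b1 b2
  set P := ∏ i ∈ T, ‖z - e (2 ^ (n + 1) + i)‖
  set P' := ∏ i ∈ T, ‖conj z - e (2 ^ (n + 1) + i)‖
  set Q := ∏ i ∈ T, ‖w - e (2 ^ (n + 1) + i)‖
  set Q' := ∏ i ∈ T, ‖conj w - e (2 ^ (n + 1) + i)‖
  have hP : 0 ≤ P := Finset.prod_nonneg fun i _ => norm_nonneg _
  have hP' : 0 ≤ P' := Finset.prod_nonneg fun i _ => norm_nonneg _
  have hQ' : 0 ≤ Q' := Finset.prod_nonneg fun i _ => norm_nonneg _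
  have c1 : ‖z - w‖ * P * P' ≤ (K₂ * (‖conj w - w‖ * Q')) * (K₁ * Q) := by
    gcongr
  have c2 : ‖conj z - w‖ * P' * P ≤ (K₂ * (‖conj w - w‖ * Q')) * (K₁ * Q) := by
    gcongr
  have c3 : ‖z - conj z‖ ≤ ‖z - w‖ + ‖conj z - w‖ := by
    rw [norm_sub_rev (conj z) w]
    exact norm_sub_le_norm_sub_add_norm_sub _ _ _
  calc ‖z - conj z‖ * ‖z ^ 2 ^ (n + 1) - 1‖ * (P * P')
      ≤ (‖z - w‖ + ‖conj z - w‖) * 2 * (P * P') := by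
        have := norm_pow_sub_one_le_two hz.le (2 ^ (n + 1))
        gcongr
    _ = 2 * (‖z - w‖ * P * P' + ‖conj z - w‖ * P' * P) := by ring
    _ ≤ 2 * ((K₂ * (‖conj w - w‖ * Q')) * (K₁ * Q) + (K₂ * (‖conj w - w‖ * Q')) * (K₁ * Q)) := by
        gcongr
    _ = 2 * K₁ * K₂ * (‖w - conj w‖ * 2 * (Q * Q')) := by
        rw [norm_sub_rev (conj w) w]; ring

theorem norm_conj_block_pow_sub (he : IsLejaSequence e) {n j : ℕ} (hj : j < 2 ^ n) :
    ‖conj (e (2 ^ (n + 1) + j)) ^ 2 ^ n - e (2 ^ (n + 1)) ^ 2 ^ n‖ = 2 := by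
  rw [← map_pow, he.block_pow hj, he.conj_pow, ← neg_add', norm_neg, ← two_mul, norm_mul,
    he.norm_pow_eq_one]
  norm_num

theorem nodeBound_blockNodes (he : IsLejaSequence e) {n m : ℕ} (hm : m ≤ 2 ^ n) {a : ℝ}
    (ha : a ∈ blockNodes e n m) :
    NodeBound (reNodes e (2 ^ (n + 1)) ∪ blockNodes e n m) a (2 * 2 ^ n * 2 ^ n) := by
  obtain ⟨j, hj, rfl⟩ := Finset.mem_image.1 ha
  have hj := Finset.mem_range.1 hj
  refine he.nodeBound_block hm hj (by positivity)
    (fun y hy => he.block_prod_erase_le hm hj hy) fun y hy => ?_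
  have h := he.block_prod_mul_le hm hy (u := conj (e (2 ^ (n + 1) + j)))
    (by rw [Complex.norm_conj, he.norm_eq_one])
  -- At the conjugate node the loss factor has its largest value 2, which turns `2 ^ (n + 1)` into
  -- `2 ^ n`.
  rw [he.norm_conj_block_pow_sub (by omega), pow_succ (2 : ℝ)] at h
  linarith

theorem nodeBound_full_blockNodes (he : IsLejaSequence e) {n : ℕ} {a : ℝ}
    (ha : a ∈ blockNodes e n (2 ^ n)) :
    NodeBound (reNodes e (2 ^ (n + 1)) ∪ blockNodes e n (2 ^ n)) a 2 := by
  obtain ⟨j, hj, rfl⟩ := Finset.mem_image.1 ha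
  have hj := Finset.mem_range.1 hj
  have h := he.nodeBound_block le_rfl hj (K₁ := 1) zero_le_one
    (fun y hy => by rw [one_mul]; exact he.full_block_prod_erase_le hj hy) fun y hy => by
      rw [one_mul, he.block_prod, he.block_prod, he.norm_conj_block_pow_sub hj]
      refine (norm_sub_le _ _).trans ?_
      rw [he.norm_pow_eq_one, norm_pow]
      linarith [pow_le_one₀ (n := 2 ^ n) (norm_nonneg y) hy]
  simpa using h

theorem nodeBound_union (he : IsLejaSequence e) {n m : ℕ} (hm : m ≤ 2 ^ n) {a C K : ℝ}
    (ha : a ∈ reNodes e (2 ^ (n + 1))) (hC : 0 ≤ C)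
    (h : NodeBound (reNodes e (2 ^ (n + 1))) a C)
    (hK : ∀ x ∈ Set.Icc (-1 : ℝ) 1, ∏ b ∈ blockNodes e n m, |x - b| ≤
      K * ∏ b ∈ blockNodes e n m, |a - b|) :
    NodeBound (reNodes e (2 ^ (n + 1)) ∪ blockNodes e n m) a (C * K) := by
  intro x hx
  have hd := he.disjoint_blockNodes hm
  have hnot : a ∉ blockNodes e n m := Finset.disjoint_left.1 hd ha
  rw [Finset.erase_union_distrib, Finset.erase_eq_of_notMem hnot,
    Finset.prod_union (hd.mono_left (Finset.erase_subset _ _)),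
    Finset.prod_union (hd.mono_left (Finset.erase_subset _ _)), mul_mul_mul_comm]
  exact mul_le_mul (h x hx) (hK x hx) (Finset.prod_nonneg fun _ _ => abs_nonneg _)
    (mul_nonneg hC (Finset.prod_nonneg fun _ _ => abs_nonneg _))

/-- The constant does not grow with `n`: a full new block contributes `‖z ^ 2 ^ (n + 1) + 1‖`,
already maximal at each old node, and new nodes get the bound 2 directly. -/
theorem nodeBound_reNodes (he : IsLejaSequence e) {n : ℕ} {a : ℝ}
    (ha : a ∈ reNodes e (2 ^ (n + 1))) : NodeBound (reNodes e (2 ^ (n + 1))) a 2 := by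
  induction n with
  | zero =>
    intro x hx
    rw [he.reNodes_two] at ha ⊢
    have h1 : ({1, -1} : Finset ℝ).erase 1 = {-1} := by
      ext y; simp only [Finset.mem_erase, Finset.mem_insert, Finset.mem_singleton]
      constructor
      · rintro ⟨h, h' | h'⟩
        · exact absurd h' h
        · exact h'
      · rintro rfl; norm_num
    have h2 : ({1, -1} : Finset ℝ).erase (-1) = {1} := by
      ext y; simp only [Finset.mem_erase, Finset.mem_insert, Finset.mem_singleton]
      constructor
      · rintro ⟨h, h' | h'⟩
        · exact h'
        · exact absurd h' h
      · rintro rfl; norm_num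
    rcases Finset.mem_insert.1 ha with rfl | ha
    · rw [h1, Finset.prod_singleton, Finset.prod_singleton, abs_le]
      norm_num
      constructor <;> linarith [hx.1, hx.2]
    · obtain rfl := Finset.mem_singleton.1 ha
      rw [h2, Finset.prod_singleton, Finset.prod_singleton, abs_le]
      norm_num
      constructor <;> linarith [hx.1, hx.2]
  | succ n ih =>
    rw [he.reNodes_succ] at ha ⊢
    rcases Finset.mem_union.1 ha with ha | ha
    · have h := he.nodeBound_union le_rfl ha zero_le_two (ih ha) (K := 1) fun x hx => by
        obtain ⟨z, hz, rfl⟩ := Complex.exists_norm_eq_one_re_eq hx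
        obtain ⟨i, hi, rfl⟩ := Finset.mem_image.1 ha
        refine le_of_mul_le_mul_left ?_ (by positivity : (0 : ℝ) < 2 ^ 2 ^ n)
        rw [one_mul, he.prod_full_blockNodes n hz, he.prod_full_blockNodes n (he.norm_eq_one i),
          he.pow_eq_one (Finset.mem_range.1 hi)]
        refine (norm_add_le _ _).trans ?_
        rw [norm_pow, hz]
        norm_num
      simpa using h
    · exact he.nodeBound_full_blockNodes ha

theorem nodeBound_reNodes_union (he : IsLejaSequence e) {n m : ℕ} (hm : m ≤ 2 ^ n) {a : ℝ}
    (ha : a ∈ reNodes e (2 ^ (n + 1))) :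
    NodeBound (reNodes e (2 ^ (n + 1)) ∪ blockNodes e n m) a (2 * (2 * 2 ^ n * 2 ^ n)) := by
  refine he.nodeBound_union hm ha zero_le_two (he.nodeBound_reNodes ha) fun x hx => ?_
  obtain ⟨z, hz, rfl⟩ := Complex.exists_norm_eq_one_re_eq hx
  obtain ⟨i, hi, rfl⟩ := Finset.mem_image.1 ha
  refine le_of_mul_le_mul_left ?_ (by positivity : (0 : ℝ) < 2 * 2 ^ m)
  rw [mul_assoc, he.prod_blockNodes hm hz, mul_assoc, mul_left_comm (2 ^ m),
    he.prod_blockNodes hm (he.norm_eq_one i)]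
  have h1 := he.block_prod_mul_le hm hz.le (he.norm_eq_one i).le
  have h2 := he.block_prod_mul_le hm (y := conj z) (u := conj (e i))
    (by rw [Complex.norm_conj, hz]) (by rw [Complex.norm_conj, he.norm_eq_one i])
  -- The two loss factors, at `e i` and its conjugate, multiply to exactly 2; this is the 2 cleared
  -- in advance beside `2 ^ m`.
  have h3 := he.norm_pow_sub_mul n (e i)
  rw [he.pow_eq_one (Finset.mem_range.1 hi)] at h3
  have h4 : ‖(1 : ℂ) + 1‖ = 2 := by norm_num
  rw [h4] at h3
  have h5 := mul_le_mul h1 h2 (mul_nonneg (Finset.prod_nonneg fun _ _ => norm_nonneg _)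
    (norm_nonneg _)) (mul_nonneg (by positivity) (Finset.prod_nonneg fun _ _ => norm_nonneg _))
  rw [mul_mul_mul_comm, h3] at h5
  refine (le_of_eq (mul_comm _ _)).trans (h5.trans (le_of_eq ?_))
  ring

end IsLejaSequence

/-! ### From node bounds to the Lebesgue constant -/

theorem lebesgueConstant_le {S : Finset (Set.Icc (-1 : ℝ) 1)} {C : ℝ} (hC : 0 ≤ C)
    (h : ∀ a ∈ S.image Subtype.val, NodeBound (S.image Subtype.val) a C) :
    lebesgueConstant S ≤ S.card * C := by
  refine ContinuousLinearMap.opNorm_le_bound _ (by positivity) fun f => ?_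
  refine (ContinuousMap.norm_le _ (by positivity)).2 fun x => ?_
  have hbasis : ∀ a ∈ S, |(Lagrange.basis S (fun b : Set.Icc (-1 : ℝ) 1 => (b : ℝ)) a).eval
      (x : ℝ)| ≤ C := by
    intro a ha
    have h1 := h a (Finset.mem_image_of_mem _ ha) x x.2
    have herase : (S.image Subtype.val).erase (a : ℝ) =
        (S.erase a).image Subtype.val :=
      (Finset.image_erase Subtype.val_injective S a).symm
    rw [herase, Finset.prod_image Subtype.val_injective.injOn,
      Finset.prod_image Subtype.val_injective.injOn] at h1
    have h2 : 0 < ∏ b ∈ S.erase a, |(a : ℝ) - b| := Finset.prod_pos fun b hb =>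
      abs_pos.2 (sub_ne_zero.2 fun h => Finset.ne_of_mem_erase hb (Subtype.ext h.symm))
    simp only [Lagrange.basis, Lagrange.basisDivisor, Polynomial.eval_prod, Polynomial.eval_mul,
      Polynomial.eval_C, Polynomial.eval_sub, Polynomial.eval_X, Finset.abs_prod, abs_mul, abs_inv,
      Finset.prod_mul_distrib, Finset.prod_inv_distrib]
    rwa [inv_mul_le_iff₀ h2, mul_comm]
  have heval : lagrangeOperator S f x = ∑ a ∈ S, f a *
      (Lagrange.basis S (fun b : Set.Icc (-1 : ℝ) 1 => (b : ℝ)) a).eval (x : ℝ) := by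
    simp [lagrangeOperator, ContinuousMap.evalCLM]
  rw [heval]
  refine (norm_sum_le _ _).trans ?_
  calc _ ≤ ∑ a ∈ S, ‖f‖ * C := Finset.sum_le_sum fun a ha => by
        rw [norm_mul]
        exact mul_le_mul (f.norm_coe_le_norm a) (hbasis a ha) (norm_nonneg _) (norm_nonneg _)
    _ = S.card * C * ‖f‖ := by rw [Finset.sum_const, nsmul_eq_mul]; ring

theorem IsRepetitionFreeSubsequence.exists_image_range_eq {α : Type*} [DecidableEq α] {s x : ℕ → α}
    (h : IsRepetitionFreeSubsequence s x) {k : ℕ} (hk : 1 ≤ k) :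
    ∃ J, k ≤ J ∧ (Finset.range k).image x = (Finset.range J).image s := by
  obtain ⟨φ, hφ, hrange, hx⟩ := h
  refine ⟨φ (k - 1) + 1, by have := hφ.id_le (k - 1); simp only [id] at this; omega, ?_⟩
  ext y
  simp only [Finset.mem_image, Finset.mem_range]
  constructor
  · rintro ⟨i, hi, rfl⟩
    exact ⟨φ i, Nat.lt_succ_of_le (hφ.monotone (by omega)), (hx i).symm⟩
  · rintro ⟨j, hj, rfl⟩
    classical
    -- The first occurrence of a value is never eliminated, so its index lies in the range of `φ`.
    have hex : ∃ l, s l = s j := ⟨j, rfl⟩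
    have hmem : Nat.find hex ∈ Set.range φ := by
      rw [hrange]
      intro l hl hl'
      exact Nat.find_min hex hl (hl'.trans (Nat.find_spec hex))
    obtain ⟨i, hi⟩ := hmem
    have h1 : φ i ≤ φ (k - 1) := by
      rw [hi]
      exact (Nat.find_min' hex rfl).trans (by omega)
    have h2 := hφ.le_iff_le.1 h1
    exact ⟨i, by omega, by rw [hx, hi, Nat.find_spec hex]⟩

theorem IsLejaSequence.exists_nodeBound_reNodes {e : ℕ → ℂ} (he : IsLejaSequence e) {J k : ℕ}
    (hJ : 2 ≤ J) (hk : (reNodes e J).card ≤ k) :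
    ∀ a ∈ reNodes e J, NodeBound (reNodes e J) a (4 * (k : ℝ) ^ 2) := by
  obtain ⟨n, hn, hn'⟩ : ∃ n, 2 ^ (n + 1) ≤ J ∧ J < 2 ^ (n + 2) := by
    have h1 : 1 ≤ Nat.log 2 J := Nat.log_pos one_lt_two hJ
    refine ⟨Nat.log 2 J - 1, ?_, ?_⟩
    · rw [Nat.sub_add_cancel h1]
      exact Nat.pow_log_le_self 2 (by omega)
    · rw [show Nat.log 2 J - 1 + 2 = Nat.log 2 J + 1 by omega]
      exact Nat.lt_pow_succ_log_self one_lt_two J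
  obtain ⟨m, hm, hS⟩ : ∃ m ≤ 2 ^ n,
      reNodes e J = reNodes e (2 ^ (n + 1)) ∪ blockNodes e n m := by
    obtain ⟨m, rfl⟩ := Nat.exists_eq_add_of_le hn
    rcases le_total m (2 ^ n) with h | h
    · exact ⟨m, h, reNodes_add e n m⟩
    -- Past the half-block no new real part appears, so `m` can be cut down to `2 ^ n`.
    · refine ⟨2 ^ n, le_rfl, ?_⟩
      rw [he.reNodes_three_mul h (by rw [pow_succ 2 (n + 1)] at hn'; omega), reNodes_add]
  rw [hS] at hk ⊢
  -- The bound goes through the number of distinct nodes, since `J` itself may exceed `k`.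
  have hN : (2 : ℝ) ^ n ≤ k := by
    have h1 := (Finset.card_le_card Finset.subset_union_left).trans hk
    rw [he.card_reNodes] at h1
    exact_mod_cast (by omega : 2 ^ n ≤ k)
  have hsq : ((2 : ℝ) ^ n) ^ 2 ≤ (k : ℝ) ^ 2 := by gcongr
  intro a ha x hx
  have h0 : 0 ≤ ∏ b ∈ (reNodes e (2 ^ (n + 1)) ∪ blockNodes e n m).erase a, |a - b| :=
    Finset.prod_nonneg fun _ _ => abs_nonneg _
  rcases Finset.mem_union.1 ha with ha | ha
  · refine (he.nodeBound_reNodes_union hm ha x hx).trans (mul_le_mul_of_nonneg_right ?_ h0)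
    nlinarith
  · refine (he.nodeBound_blockNodes hm ha x hx).trans (mul_le_mul_of_nonneg_right ?_ h0)
    nlinarith [sq_nonneg ((2 : ℝ) ^ n)]

theorem IsReLejaSequence.lebesgueConstant_le {X : ℕ → Set.Icc (-1 : ℝ) 1}
    (hX : IsReLejaSequence X) {k : ℕ} (hk : 2 ≤ k) :
    lebesgueConstant ((Finset.range k).image X) ≤ 4 * (k : ℝ) ^ 3 := by
  obtain ⟨e, he, hx⟩ := hX
  obtain ⟨J, hJ, hS⟩ := hx.exists_image_range_eq (k := k) (by omega)
  have himage : ((Finset.range k).image X).image Subtype.val = reNodes e J := by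
    rw [Finset.image_image]
    exact hS
  have hcard : ((Finset.range k).image X).card ≤ k :=
    Finset.card_image_le.trans (Finset.card_range k).le
  have hcard' : (reNodes e J).card ≤ k := by
    rw [← himage]
    exact Finset.card_image_le.trans hcard
  refine (_root_.lebesgueConstant_le (C := 4 * (k : ℝ) ^ 2) (by positivity) ?_).trans ?_
  · rw [himage]
    exact he.exists_nodeBound_reNodes (hk.trans hJ) hcard'
  · calc _ ≤ (k : ℝ) * (4 * (k : ℝ) ^ 2) := by gcongr
      _ = _ := by ring

theorem theorem3p1 (X : ℕ → Set.Icc (-1 : ℝ) 1) (hX : IsReLejaSequence X) :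
    Asymptotics.IsBigO Filter.atTop
      (fun k : ℕ => lebesgueConstant ((Finset.range k).image X))
      (fun k : ℕ => (k : ℝ) ^ 3 * Real.log k) := by
  refine Asymptotics.IsBigO.of_bound 4 ?_
  -- From `k = 3 > exp 1` on, the logarithm is at least 1 and can simply be inserted.
  filter_upwards [Filter.eventually_ge_atTop 3] with k hk
  have h1 : 1 ≤ Real.log k := by
    rw [Real.le_log_iff_exp_le (by positivity)]
    have : (3 : ℝ) ≤ k := by exact_mod_cast hk
    linarith [Real.exp_one_lt_d9]
  have h2 : 0 ≤ lebesgueConstant ((Finset.range k).image X) :=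
    norm_nonneg (lagrangeOperator ((Finset.range k).image X))
  rw [Real.norm_of_nonneg h2, Real.norm_of_nonneg (by positivity)]
  refine (hX.lebesgueConstant_le (by omega)).trans ?_
  have h3 : (0 : ℝ) ≤ (k : ℝ) ^ 3 := by positivity
  nlinarith
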